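/- Let $\mathbb{F}_2$ be the field with two elements and let $A$ be an $n \times n$ matrix over $\mathbb{F}_2$. Then there exist $n \times n$ matrices $N$ and $D$ over $\mathbb{F}_2$ such that $A = N + D$, $N^2 = 0$ and $D^4 = D$. -/

import Mathlib

/-!
A matrix over `𝔽₂` makes `𝔽₂ⁿ` an `𝔽₂[X]`-module, a direct sum of modules `𝔽₂[X] / (f)`. It
therefore suffices to split multiplication by `X` on `𝔽₂[X] / (f)`, for `f` monic of degree `n`, as
`N + D` with `N² = 0` and `D⁴ = D` (`Decomposes f`, proved in `decomposes_of_monic`).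

Suppose that `f = X * g - r` with `deg r < deg g`. The quotient has the subspace `V` of polynomials
of degree less than `deg g` and, modulo `V`, the single basis vector `g`; here `X * g` equals `r`.
On `V`, multiplication by `X` is multiplication modulo `g` plus the top coefficient times `g`.
If multiplication modulo `g` is `N + D` with `N² = 0` and `D³ = 1`, and the top coefficient vanishes
on the image of `N`, then the top-coefficient term may be put into `N`, and `D g = r` extends `D`:
as `D³ = 1` on `V`, any `r ∈ V` gives `D⁴ = D`
(`CubeRootDecomposes.decomposes`). The same gluing shows that the admissible `g` include the
products of divisors of `X³ - 1` in which all factors but the first have degree at least two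
(`CubeRootDecomposes.mul`). So `f` decomposes as soon as such a `g` has degree `n - 1` and the same
second coefficient as `f`.

Put `W = X² + X + 1`. For odd `n`, one of `f(X)`, `f(X + 1)` is matched by a power of `W`; passing
from `f(X)` to `f(X + 1)` replaces `D` by `D + 1`, which is again a root of `X⁴ - X`
(`Decomposes.of_shift`). For even `n`, the two values of the second coefficient are matched by
`(X + 1) * W ^ k` and, if `n ≥ 8`, by `(X + 1) * (X³ - 1)² * W ^ k`. What is left is one value of
the second coefficient in each of the degrees 2, 4 and 6. There the shift normalizes one more
coefficient, and `N` and `D` are given explicitly (`decomposes_X_sq`, `decomposes_quartic`,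
`decomposes_sextic`).
-/

open Polynomial

/-! ### Division with remainder as a decomposition of spaces of polynomials -/

theorem exists_eq_add_mul_of_mem_degreeLT {g p : (ZMod 2)[X]} (hg : g.Monic) {k : ℕ}
    (hp : p ∈ degreeLT (ZMod 2) (g.natDegree + k)) :
    ∃ p₁ ∈ degreeLT (ZMod 2) g.natDegree, ∃ p₂ ∈ degreeLT (ZMod 2) k, p = p₁ + g * p₂ := by
  have h₁ : (p %ₘ g).degree < g.natDegree := by
    rw [← degree_eq_natDegree hg.ne_zero]; exact degree_modByMonic_lt p hg
  refine ⟨p %ₘ g, mem_degreeLT.2 h₁, p /ₘ g, ?_, (modByMonic_add_div p g).symm⟩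
  by_cases h : p /ₘ g = 0
  · rw [h]; exact Submodule.zero_mem _
  have hle : g.degree ≤ p.degree := by
    by_contra hlt
    exact h ((divByMonic_eq_zero_iff hg).2 (not_le.1 hlt))
  have hd := degree_add_divByMonic hg hle
  rw [mem_degreeLT] at hp ⊢
  rw [← hd, degree_eq_natDegree hg.ne_zero, degree_eq_natDegree h] at hp
  rw [degree_eq_natDegree h]
  norm_cast at hp ⊢
  omega

theorem div_mod_add_mul {g p₁ : (ZMod 2)[X]} (hg : g.Monic)
    (h₁ : p₁ ∈ degreeLT (ZMod 2) g.natDegree) (p₂ : (ZMod 2)[X]) :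
    (p₁ + g * p₂) /ₘ g = p₂ ∧ (p₁ + g * p₂) %ₘ g = p₁ := by
  refine div_modByMonic_unique _ _ hg ⟨rfl, ?_⟩
  rw [degree_eq_natDegree hg.ne_zero]
  exact mem_degreeLT.1 h₁

theorem modByMonic_mem_degreeLT {g : (ZMod 2)[X]} (hg : g.Monic) (p : (ZMod 2)[X]) :
    p %ₘ g ∈ degreeLT (ZMod 2) g.natDegree := by
  rw [mem_degreeLT, ← degree_eq_natDegree hg.ne_zero]; exact degree_modByMonic_lt p hg

/-- The linear map that sends `p₁ + g * p₂`, where `p₁` has degree less than that of the monic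
polynomial `g`, to `φ₁ p₁ + φ₂ p₂`. -/
noncomputable def glue {g : (ZMod 2)[X]} (hg : g.Monic)
    (φ₁ φ₂ : (ZMod 2)[X] →ₗ[ZMod 2] (ZMod 2)[X]) :
    (ZMod 2)[X] →ₗ[ZMod 2] (ZMod 2)[X] where
  toFun p := φ₁ (p %ₘ g) + φ₂ (p /ₘ g)
  map_add' p q := by
    have h := div_mod_add_mul hg
      (Submodule.add_mem _ (modByMonic_mem_degreeLT hg p) (modByMonic_mem_degreeLT hg q))
      (p /ₘ g + q /ₘ g)
    have e : p %ₘ g + q %ₘ g + g * (p /ₘ g + q /ₘ g) = p + q := by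
      linear_combination modByMonic_add_div p g + modByMonic_add_div q g
    rw [e] at h
    rw [h.1, h.2, map_add, map_add]
    abel
  map_smul' c p := by
    have h := div_mod_add_mul hg
      (Submodule.smul_mem _ c (modByMonic_mem_degreeLT hg p)) (c • (p /ₘ g))
    rw [mul_smul_comm, ← smul_add, modByMonic_add_div] at h
    rw [h.1, h.2, map_smul, map_smul, smul_add]
    rfl

theorem glue_apply {g p₁ : (ZMod 2)[X]} (hg : g.Monic)
    (φ₁ φ₂ : (ZMod 2)[X] →ₗ[ZMod 2] (ZMod 2)[X])
    (h₁ : p₁ ∈ degreeLT (ZMod 2) g.natDegree) (p₂ : (ZMod 2)[X]) :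
    glue hg φ₁ φ₂ (p₁ + g * p₂) = φ₁ p₁ + φ₂ p₂ := by
  change φ₁ _ + φ₂ _ = _
  rw [(div_mod_add_mul hg h₁ p₂).1, (div_mod_add_mul hg h₁ p₂).2]

theorem glue_apply_of_mem {g p : (ZMod 2)[X]} (hg : g.Monic)
    (φ₁ φ₂ : (ZMod 2)[X] →ₗ[ZMod 2] (ZMod 2)[X])
    (h : p ∈ degreeLT (ZMod 2) g.natDegree) : glue hg φ₁ φ₂ p = φ₁ p := by
  simpa using glue_apply hg φ₁ φ₂ h 0

/-- The linear map `p ↦ X * p %ₘ h`, multiplication by `X` modulo `h`. -/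
noncomputable def mulXMod (h : (ZMod 2)[X]) : (ZMod 2)[X] →ₗ[ZMod 2] (ZMod 2)[X] :=
  modByMonicHom h ∘ₗ LinearMap.mulLeft (ZMod 2) X

theorem mulXMod_apply (h p : (ZMod 2)[X]) : mulXMod h p = (X * p) %ₘ h := rfl

theorem modByMonic_eq_self_of_mem {h p : (ZMod 2)[X]} (hh : h.Monic)
    (hp : p ∈ degreeLT (ZMod 2) h.natDegree) : p %ₘ h = p := by
  simpa using (div_mod_add_mul hh hp 0).2

theorem mulXMod_iterate {h p : (ZMod 2)[X]} (hh : h.Monic)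
    (hp : p ∈ degreeLT (ZMod 2) h.natDegree) (k : ℕ) :
    (mulXMod h)^[k] p = (X ^ k * p) %ₘ h := by
  induction k with
  | zero => simpa using (modByMonic_eq_self_of_mem hh hp).symm
  | succ k ih =>
    rw [Function.iterate_succ_apply', ih, mulXMod_apply]
    refine modByMonic_eq_of_dvd_sub hh ⟨-(X * ((X ^ k * p) /ₘ h)), ?_⟩
    linear_combination X * modByMonic_add_div (X ^ k * p) h

/-- For `deg p < deg h`, the quotient of `X * p` by `h` is the top coefficient of `p`. -/
theorem eq_modByMonic_add_coeff_mul {h p : (ZMod 2)[X]} (hh : h.Monic)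
    (hp : p ∈ degreeLT (ZMod 2) h.natDegree) :
    X * p = (X * p) %ₘ h + C (p.coeff (h.natDegree - 1)) * h := by
  by_cases hd : h.natDegree = 0
  · have hp0 : p = 0 := by
      rw [hd, mem_degreeLT] at hp
      simpa using hp
    simp [hp0]
  have key : X * p - C (p.coeff (h.natDegree - 1)) * h ∈ degreeLT (ZMod 2) h.natDegree := by
    rw [mem_degreeLT, degree_lt_iff_coeff_zero] at hp ⊢
    intro m hm
    obtain ⟨m, rfl⟩ : ∃ k, m = k + 1 := ⟨m - 1, by omega⟩
    rw [coeff_sub, coeff_X_mul, coeff_C_mul]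
    rcases hm.eq_or_lt with hm | hm
    · rw [← hm, hh.coeff_natDegree]; simp [hm]
    · rw [coeff_eq_zero_of_natDegree_lt hm, hp m (by omega)]; simp
  have := (div_mod_add_mul hh key (C (p.coeff (h.natDegree - 1)))).2
  rw [show X * p - C (p.coeff (h.natDegree - 1)) * h + h * C (p.coeff (h.natDegree - 1)) = X * p
    by ring] at this
  rw [this]; ring

/-! ### Decompositions modulo a polynomial -/

/-- Multiplication by `X` on `𝔽₂[X] / (f)` is the sum of a square-zero map `N` and a map `D` with
`D⁴ = D`. The elements of the quotient are represented by the polynomials of degree less than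
that of `f`, and only the values of `N` and `D` on these matter. -/
def Decomposes (f : (ZMod 2)[X]) : Prop :=
  ∃ N D : (ZMod 2)[X] →ₗ[ZMod 2] (ZMod 2)[X], ∀ p ∈ degreeLT (ZMod 2) f.natDegree,
    N p ∈ degreeLT (ZMod 2) f.natDegree ∧ D p ∈ degreeLT (ZMod 2) f.natDegree ∧
    f ∣ X * p - (N p + D p) ∧ N (N p) = 0 ∧ D (D (D (D p))) = D p

/-- Multiplication by `X` on the polynomials of degree less than `d = deg g`, up to a multiple of
`g`, is the sum of a square-zero map `N` and a map `D` with `D³ = 1`; moreover the coefficient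
of `X ^ (d - 1)` vanishes on the image of `N`, so that adding to `N` the term that carries this
coefficient to a new basis vector `g` keeps its square zero. -/
def CubeRootDecomposes (g : (ZMod 2)[X]) : Prop :=
  ∃ N D : (ZMod 2)[X] →ₗ[ZMod 2] (ZMod 2)[X], ∀ p ∈ degreeLT (ZMod 2) g.natDegree,
    N p ∈ degreeLT (ZMod 2) (g.natDegree - 1) ∧ D p ∈ degreeLT (ZMod 2) g.natDegree ∧
    X * p = N p + D p + C (p.coeff (g.natDegree - 1)) * g ∧ N (N p) = 0 ∧ D (D (D p)) = p

theorem mulXMod_cube {h p : (ZMod 2)[X]} (hh : h.Monic) (hdvd : h ∣ X ^ 3 - 1)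
    (hp : p ∈ degreeLT (ZMod 2) h.natDegree) : mulXMod h (mulXMod h (mulXMod h p)) = p := by
  have h1 := mulXMod_iterate hh hp 3
  rw [modByMonic_eq_of_dvd_sub (p₂ := p) hh, modByMonic_eq_self_of_mem hh hp] at h1
  · exact h1
  · rw [show X ^ 3 * p - p = (X ^ 3 - 1) * p by ring]
    exact hdvd.mul_right p

theorem cubeRootDecomposes_of_dvd {h : (ZMod 2)[X]} (hh : h.Monic) (hdvd : h ∣ X ^ 3 - 1) :
    CubeRootDecomposes h := by
  refine ⟨0, mulXMod h, fun p hp => ⟨Submodule.zero_mem _, modByMonic_mem_degreeLT hh _, ?_, rfl,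
    mulXMod_cube hh hdvd hp⟩⟩
  simpa [mulXMod_apply] using eq_modByMonic_add_coeff_mul hh hp

theorem mul_mem_degreeLT {g p : (ZMod 2)[X]} {k : ℕ} (hg : g.Monic)
    (hp : p ∈ degreeLT (ZMod 2) k) : g * p ∈ degreeLT (ZMod 2) (g.natDegree + k) := by
  rw [mem_degreeLT] at hp ⊢
  by_cases h0 : p = 0
  · simp [h0]
  · rw [degree_mul, degree_eq_natDegree hg.ne_zero]
    rw [degree_eq_natDegree h0] at hp ⊢
    norm_cast at hp ⊢
    omega

theorem coeff_add_mul_top {g p₁ p₂ : (ZMod 2)[X]} {k : ℕ} (hg : g.Monic) (hk : 1 ≤ k)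
    (h₁ : p₁ ∈ degreeLT (ZMod 2) g.natDegree) (h₂ : p₂ ∈ degreeLT (ZMod 2) k) :
    (p₁ + g * p₂).coeff (g.natDegree + k - 1) = p₂.coeff (k - 1) := by
  rw [mem_degreeLT] at h₁ h₂
  have h₂' : p₂.natDegree ≤ k - 1 := by
    by_cases h0 : p₂ = 0
    · simp [h0]
    · rw [degree_eq_natDegree h0] at h₂
      norm_cast at h₂
      omega
  have h₁' : p₁.coeff (g.natDegree + (k - 1)) = 0 :=
    coeff_eq_zero_of_degree_lt (h₁.trans_le (by exact_mod_cast Nat.le_add_right _ _))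
  rw [Nat.add_sub_assoc hk, coeff_add, h₁', coeff_mul_add_eq_of_natDegree_le le_rfl h₂',
    hg.coeff_natDegree]
  simp

/-- The linear map that sends `p` to `q` times the coefficient of `X ^ k` in `p`. -/
noncomputable def coeffMul (k : ℕ) (q : (ZMod 2)[X]) : (ZMod 2)[X] →ₗ[ZMod 2] (ZMod 2)[X] :=
  (lcoeff (ZMod 2) k).smulRight q

theorem coeffMul_apply (k : ℕ) (q p : (ZMod 2)[X]) : coeffMul k q p = C (p.coeff k) * q := by
  simp [coeffMul, smul_eq_C_mul]

/-- The polynomials of degree less than `deg (g * h)` are the `p₁ + g * p₂` with `deg p₁ < deg g`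
and `deg p₂ < deg h`. The new `D` is the old one on `p₁` and multiplication by `X` modulo `h` on
`p₂`; the new `N` is the old one plus the top coefficient of `p₁` times `g`. As `deg h ≥ 2`, the
coefficient of `g` is not the top one, so the image of the new `N` still has vanishing top
coefficient. -/
theorem CubeRootDecomposes.mul {g h : (ZMod 2)[X]} (hdec : CubeRootDecomposes g) (hg : g.Monic)
    (hh : h.Monic) (hdvd : h ∣ X ^ 3 - 1) (hdeg : 2 ≤ h.natDegree) :
    CubeRootDecomposes (g * h) := by
  obtain ⟨N, D, hND⟩ := hdec
  have hnd : (g * h).natDegree = g.natDegree + h.natDegree := hg.natDegree_mul hh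
  set d := g.natDegree with hd
  set N' := glue hg (N + coeffMul (d - 1) g) 0 with hN'
  set D' := glue hg D (LinearMap.mulLeft (ZMod 2) g ∘ₗ mulXMod h) with hD'
  have hNs : ∀ p₁ ∈ degreeLT (ZMod 2) d, ∀ p₂, N' (p₁ + g * p₂) =
      N p₁ + g * C (p₁.coeff (d - 1)) := by
    intro p₁ h₁ p₂
    rw [hN', glue_apply hg _ _ h₁, LinearMap.add_apply, coeffMul_apply, LinearMap.zero_apply]
    ring
  have hDs : ∀ p₁ ∈ degreeLT (ZMod 2) d, ∀ p₂, D' (p₁ + g * p₂) =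
      D p₁ + g * mulXMod h p₂ := by
    intro p₁ h₁ p₂
    rw [hD', glue_apply hg _ _ h₁]
    rfl
  refine ⟨N', D', fun p hp => ?_⟩
  rw [hnd] at hp ⊢
  obtain ⟨p₁, h₁, p₂, h₂, rfl⟩ := exists_eq_add_mul_of_mem_degreeLT hg hp
  obtain ⟨e1, e2, e3, e4, e5⟩ := hND p₁ h₁
  have e1' : N p₁ ∈ degreeLT (ZMod 2) d := degreeLT_mono (Nat.sub_le _ _) e1
  have hm : ∀ q, mulXMod h q ∈ degreeLT (ZMod 2) h.natDegree :=
    fun q => modByMonic_mem_degreeLT hh _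
  refine ⟨?_, ?_, ?_, ?_, ?_⟩
  · rw [hNs _ h₁]
    refine Submodule.add_mem _ (degreeLT_mono (by omega) e1) ?_
    refine degreeLT_mono (m := d + 1) (by omega) (mul_mem_degreeLT hg ?_)
    rw [mem_degreeLT]
    exact degree_C_le.trans_lt (by simp)
  · rw [hDs _ h₁]
    exact Submodule.add_mem _ (degreeLT_mono (Nat.le_add_right _ _) e2)
      (mul_mem_degreeLT hg (hm _))
  · rw [hNs _ h₁, hDs _ h₁, coeff_add_mul_top hg (by omega) h₁ h₂]
    have := eq_modByMonic_add_coeff_mul hh h₂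
    rw [← mulXMod_apply] at this
    linear_combination e3 + g * this
  · rw [hNs _ h₁, hNs _ e1', e4]
    have : (N p₁).coeff (d - 1) = 0 :=
      coeff_eq_zero_of_degree_lt (mem_degreeLT.1 e1)
    simp [this]
  · rw [hDs _ h₁, hDs _ e2, hDs _ (hND _ e2).2.1, e5, mulXMod_cube hh hdvd h₂]

/-- The quotient by `X * g - r` has one basis vector `g` on top of the polynomials of degree less
than `deg g`. Extend `D` by `D g = r` and `N` by `N g = 0`; then `D⁴ g = D³ r = r = D g`. -/
theorem CubeRootDecomposes.decomposes {g r : (ZMod 2)[X]} (hdec : CubeRootDecomposes g)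
    (hg : g.Monic) (hr : r ∈ degreeLT (ZMod 2) g.natDegree) : Decomposes (X * g - r) := by
  obtain ⟨N, D, hND⟩ := hdec
  have hnd : (X * g - r).natDegree = g.natDegree + 1 := by
    rw [natDegree_sub_eq_left_of_natDegree_lt, natDegree_X_mul hg.ne_zero]
    rw [natDegree_X_mul hg.ne_zero]
    by_cases h0 : r = 0
    · simp [h0]
    rw [mem_degreeLT, degree_eq_natDegree h0] at hr
    norm_cast at hr
    omega
  set d := g.natDegree with hd
  set N' := glue hg (N + coeffMul (d - 1) g) 0 with hN'
  set D' := glue hg D (LinearMap.mulRight (ZMod 2) r) with hD'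
  have hNs : ∀ p₁ ∈ degreeLT (ZMod 2) d, ∀ p₂, N' (p₁ + g * p₂) =
      N p₁ + g * C (p₁.coeff (d - 1)) := by
    intro p₁ h₁ p₂
    rw [hN', glue_apply hg _ _ h₁, LinearMap.add_apply, coeffMul_apply, LinearMap.zero_apply]
    ring
  have hDs : ∀ p₁ ∈ degreeLT (ZMod 2) d, ∀ p₂, D' (p₁ + g * p₂) = D p₁ + p₂ * r := by
    intro p₁ h₁ p₂
    rw [hD', glue_apply hg _ _ h₁]
    rfl
  have hD0 : ∀ p₁ ∈ degreeLT (ZMod 2) d, D' p₁ = D p₁ :=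
    fun p₁ h₁ => glue_apply_of_mem hg _ _ h₁
  have hC : ∀ c : ZMod 2, C c ∈ degreeLT (ZMod 2) 1 := fun c => by
    rw [mem_degreeLT]
    exact degree_C_le.trans_lt (by simp)
  refine ⟨N', D', fun p hp => ?_⟩
  rw [hnd] at hp ⊢
  obtain ⟨p₁, h₁, p₂, h₂, rfl⟩ := exists_eq_add_mul_of_mem_degreeLT hg hp
  obtain ⟨c, rfl⟩ : ∃ c, p₂ = C c := by
    rw [mem_degreeLT] at h₂
    exact ⟨_, eq_C_of_degree_le_zero (Nat.WithBot.lt_one_iff_le_zero.1 (by exact_mod_cast h₂))⟩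
  obtain ⟨e1, e2, e3, e4, e5⟩ := hND p₁ h₁
  have e1' : N p₁ ∈ degreeLT (ZMod 2) d := degreeLT_mono (Nat.sub_le _ _) e1
  have hDp : D p₁ + C c * r ∈ degreeLT (ZMod 2) d := by
    rw [← smul_eq_C_mul]
    exact Submodule.add_mem _ e2 (Submodule.smul_mem _ _ hr)
  refine ⟨?_, ?_, ?_, ?_, ?_⟩
  · rw [hNs _ h₁]
    exact Submodule.add_mem _ (degreeLT_mono (by omega) e1) (mul_mem_degreeLT hg (hC _))
  · rw [hDs _ h₁]
    exact degreeLT_mono (Nat.le_succ _) hDp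
  · rw [hNs _ h₁, hDs _ h₁]
    exact ⟨C c, by linear_combination e3⟩
  · rw [hNs _ h₁, hNs _ e1', e4]
    have : (N p₁).coeff (d - 1) = 0 :=
      coeff_eq_zero_of_degree_lt (mem_degreeLT.1 e1)
    simp [this]
  · obtain ⟨-, f2, -, -, f5⟩ := hND _ hDp
    rw [hDs _ h₁, hD0 _ hDp, hD0 _ f2, hD0 _ (hND _ f2).2.1, f5]

/-! ### Explicit decompositions in degrees two, four and six -/

theorem decomposes_X_sq : Decomposes (X ^ 2 : (ZMod 2)[X]) := by
  refine ⟨mulXMod (X ^ 2), 0, fun p hp => ⟨modByMonic_mem_degreeLT (monic_X_pow 2) _,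
    Submodule.zero_mem _, ?_, ?_, rfl⟩⟩
  · refine ⟨(X * p) /ₘ X ^ 2, ?_⟩
    rw [mulXMod_apply, LinearMap.zero_apply]
    linear_combination -(modByMonic_add_div (X * p) (X ^ 2 : (ZMod 2)[X]))
  · have := mulXMod_iterate (monic_X_pow 2) hp 2
    rw [(modByMonic_eq_zero_iff_dvd (monic_X_pow 2)).2 (dvd_mul_right _ _)] at this
    exact this

/-- In the quotient, `D` sends `1 ↦ 0`, `X ↦ X ^ 2`, `X ^ 2 ↦ y` and `y ↦ y + X ^ 2`, where
`y = X ^ 3 + a * X`. So `D` kills `1` and acts on the span of `X`, `X ^ 2`, `y` as a companion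
matrix of the divisor `X ^ 3 + X ^ 2 + X` of `X ^ 4 - X`. -/
theorem decomposes_quartic (a c : ZMod 2) :
    Decomposes (X ^ 4 + X ^ 3 + X ^ 2 + C c * X + C a) := by
  have two : (2 : (ZMod 2)[X]) = 0 := CharTwo.two_eq_zero
  have hnd : (X ^ 4 + X ^ 3 + X ^ 2 + C c * X + C a).natDegree = 4 := by compute_degree!
  obtain ⟨v, hv⟩ : ∃ v : ZMod 2 → ZMod 2 → ZMod 2 → ZMod 2 → (ZMod 2)[X], ∀ p₀ p₁ p₂ p₃,
      v p₀ p₁ p₂ p₃ = C p₀ + C p₁ * X + C p₂ * X ^ 2 + C p₃ * X ^ 3 :=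
    ⟨_, fun _ _ _ _ => rfl⟩
  have hv4 : ∀ p₀ p₁ p₂ p₃, v p₀ p₁ p₂ p₃ ∈ degreeLT (ZMod 2) 4 := by
    intro p₀ p₁ p₂ p₃
    rw [mem_degreeLT, hv]
    compute_degree!
  obtain ⟨N, hN⟩ : ∃ N : (ZMod 2)[X] →ₗ[ZMod 2] (ZMod 2)[X], ∀ p₀ p₁ p₂ p₃,
      N (v p₀ p₁ p₂ p₃) = v (a * p₃) (p₀ + a * p₂ + (a + c) * p₃) (a * p₃) 0 := by
    refine ⟨coeffMul 0 X + coeffMul 2 (C a * X) +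
      coeffMul 3 (C a + C (a + c) * X + C a * X ^ 2), fun p₀ p₁ p₂ p₃ => ?_⟩
    simp only [hv, LinearMap.add_apply, coeffMul_apply, coeff_add, coeff_C_mul, coeff_X_pow,
      coeff_X, coeff_C]
    simp
    ring
  obtain ⟨D, hD⟩ : ∃ D : (ZMod 2)[X] →ₗ[ZMod 2] (ZMod 2)[X], ∀ p₀ p₁ p₂ p₃,
      D (v p₀ p₁ p₂ p₃) = v 0 (a * p₂ + a * p₃) (p₁ + (a + 1) * p₃) (p₂ + p₃) := by
    refine ⟨coeffMul 1 (X ^ 2) + coeffMul 2 (C a * X + X ^ 3) +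
      coeffMul 3 (C a * X + C (a + 1) * X ^ 2 + X ^ 3), fun p₀ p₁ p₂ p₃ => ?_⟩
    simp only [hv, LinearMap.add_apply, coeffMul_apply, coeff_add, coeff_C_mul, coeff_X_pow,
      coeff_X, coeff_C]
    simp
    ring
  refine ⟨N, D, fun p hp => ?_⟩
  rw [hnd] at hp ⊢
  obtain ⟨p₀, p₁, p₂, p₃, rfl⟩ : ∃ p₀ p₁ p₂ p₃, p = v p₀ p₁ p₂ p₃ := by
    refine ⟨p.coeff 0, p.coeff 1, p.coeff 2, p.coeff 3, ?_⟩
    have : p.natDegree < 4 := by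
      by_cases h0 : p = 0
      · simp [h0]
      · rw [mem_degreeLT, degree_eq_natDegree h0] at hp
        exact_mod_cast hp
    conv_lhs => rw [p.as_sum_range_C_mul_X_pow' this]
    simp [Finset.sum_range_succ, hv]
  refine ⟨hN _ _ _ _ ▸ hv4 _ _ _ _, hD _ _ _ _ ▸ hv4 _ _ _ _, ⟨C p₃, ?_⟩, ?_, ?_⟩
  · rw [hN, hD, hv, hv, hv]
    simp only [map_add, map_mul, map_zero, map_one]
    linear_combination -(C a * C p₃ + (C a * C p₂ + C a * C p₃ + C c * C p₃) * X +
      (C a * C p₃ + C p₃) * X ^ 2 + C p₃ * X ^ 3) * two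
  · rw [hN, hN]
    have : ∀ b q : ZMod 2, b * q + b * (b * q) = 0 := by decide
    simp only [hv, mul_zero, this, map_zero, zero_mul, add_zero]
  · rw [hD, hD, hD, hD]
    clear hv hv4 hN hD hnd hp
    congr 1 <;> revert a p₁ p₂ p₃ <;> decide

/-- With `h = X ^ 3 + X ^ 2 + X`, a divisor of `X ^ 4 - X`, and `g = h + a * X`, represent the
quotient by the `p₁ + g * p₂` with `deg p₁, deg p₂ < 3`. Then `D` is multiplication by `X` modulo
`h` on both `p₁` and `p₂`. The difference `N` depends only on the two coefficients of `X ^ 2`, in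
`p₁` and in `p₂`, and these vanish on its image. -/
theorem decomposes_sextic (a t c d : ZMod 2) :
    Decomposes ((X ^ 3 + X ^ 2 + X) ^ 2 + C a * X ^ 2 + C t * (X ^ 3 + X ^ 2 + X) +
      C c * X + C d) := by
  have two : (2 : (ZMod 2)[X]) = 0 := CharTwo.two_eq_zero
  obtain ⟨h, hh⟩ : ∃ h : (ZMod 2)[X], h = X ^ 3 + X ^ 2 + X := ⟨_, rfl⟩
  obtain ⟨g, hg⟩ : ∃ g : (ZMod 2)[X], g = h + C a * X := ⟨_, rfl⟩
  have hhm : h.Monic := by rw [hh]; monicity!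
  have hgm : g.Monic := by rw [hg, hh]; monicity!
  have hhd : h.natDegree = 3 := by rw [hh]; compute_degree!
  have hgd : g.natDegree = 3 := by rw [hg, hh]; compute_degree!
  have hnd : ((X ^ 3 + X ^ 2 + X) ^ 2 + C a * X ^ 2 + C t * (X ^ 3 + X ^ 2 + X) +
      C c * X + C d).natDegree = 6 := by compute_degree!
  have hsq : C a * C a = C a := by
    rw [← C_mul, (by decide : ∀ b : ZMod 2, b * b = b) a]
  rw [← hh] at hnd ⊢
  have lin : ∀ u w : ZMod 2, C u * X + C w ∈ degreeLT (ZMod 2) 2 := by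
    intro u w
    rw [mem_degreeLT]
    exact degree_linear_lt
  set N := glue hgm (coeffMul 2 h)
    (coeffMul 2 (C (t * a + c) * X + C d + g * (C a * X + C t))) with hN
  set D := glue hgm (mulXMod h) (LinearMap.mulLeft (ZMod 2) g ∘ₗ mulXMod h) with hD
  have hNs : ∀ p₁ ∈ degreeLT (ZMod 2) 3, ∀ p₂, N (p₁ + g * p₂) =
      C (p₁.coeff 2) * h +
        C (p₂.coeff 2) * (C (t * a + c) * X + C d + g * (C a * X + C t)) := by
    intro p₁ h₁ p₂
    rw [← hgd] at h₁
    rw [hN, glue_apply hgm _ _ h₁, coeffMul_apply, coeffMul_apply]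
  have hDs : ∀ p₁ ∈ degreeLT (ZMod 2) 3, ∀ p₂, D (p₁ + g * p₂) =
      mulXMod h p₁ + g * mulXMod h p₂ := by
    intro p₁ h₁ p₂
    rw [← hgd] at h₁
    rw [hD, glue_apply hgm _ _ h₁]
    rfl
  have hm : ∀ q, mulXMod h q ∈ degreeLT (ZMod 2) 3 :=
    fun q => hhd ▸ modByMonic_mem_degreeLT hhm _
  have hm4 : ∀ q ∈ degreeLT (ZMod 2) 3,
      mulXMod h (mulXMod h (mulXMod h (mulXMod h q))) = mulXMod h q := by
    intro q hq
    rw [← hhd] at hq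
    refine (mulXMod_iterate hhm hq 4).trans (modByMonic_eq_of_dvd_sub hhm ⟨(X - 1) * q, ?_⟩)
    rw [LinearMap.mulLeft_apply, hh]
    ring
  refine ⟨N, D, fun p hp => ?_⟩
  rw [hnd] at hp ⊢
  obtain ⟨p₁, h₁, p₂, h₂, rfl⟩ :=
    exists_eq_add_mul_of_mem_degreeLT (k := 3) hgm (by rwa [hgd])
  rw [hgd] at h₁
  have hNp : N (p₁ + g * p₂) = (C (p₁.coeff 2 * a + p₂.coeff 2 * (t * a + c)) * X +
      C (p₂.coeff 2 * d)) +
      g * (C (p₂.coeff 2 * a) * X + C (p₁.coeff 2 + p₂.coeff 2 * t)) := by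
    rw [hNs _ h₁]
    simp only [map_add, map_mul]
    linear_combination (- C (p₁.coeff 2)) * hg - C (p₁.coeff 2) * C a * X * two
  refine ⟨?_, ?_, ?_, ?_, ?_⟩
  · rw [hNp]
    refine Submodule.add_mem _ (degreeLT_mono (by omega) (lin _ _))
      (degreeLT_mono ?_ (mul_mem_degreeLT hgm (lin _ _)))
    omega
  · rw [hDs _ h₁]
    refine Submodule.add_mem _ (degreeLT_mono (by omega) (hm _))
      (degreeLT_mono ?_ (mul_mem_degreeLT hgm (hm _)))
    omega
  · rw [hNs _ h₁, hDs _ h₁]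
    have e1 := eq_modByMonic_add_coeff_mul hhm (hhd ▸ h₁)
    have e2 := eq_modByMonic_add_coeff_mul hhm (hhd ▸ h₂)
    rw [← mulXMod_apply, hhd] at e1 e2
    refine ⟨C (p₂.coeff 2), ?_⟩
    simp only [map_add, map_mul]
    linear_combination e1 + g * e2 + C (p₂.coeff 2) * (h - C a * X - C t) * hg -
      C (p₂.coeff 2) * X ^ 2 * hsq -
      C (p₂.coeff 2) * (C a * X ^ 2 + C t * h + C t * C a * X + C c * X + C d) * two
  · rw [hNp, hNs]
    · simp
    · exact degreeLT_mono (by omega) (lin _ _)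
  · rw [hDs _ h₁, hDs _ (hm _), hDs _ (hm _), hDs _ (hm _), hm4 _ h₁, hm4 _ h₂]

/-! ### The substitution `X ↦ X + 1` -/

/-- The substitution `X ↦ X + 1`, an involution in characteristic two. -/
noncomputable def shift : (ZMod 2)[X] →ₗ[ZMod 2] (ZMod 2)[X] :=
  (aeval (X + 1 : (ZMod 2)[X])).toLinearMap

theorem shift_apply (p : (ZMod 2)[X]) : shift p = p.comp (X + 1) := rfl

theorem natDegree_shift (p : (ZMod 2)[X]) : (shift p).natDegree = p.natDegree := by
  rw [shift_apply, natDegree_comp, show (X + 1 : (ZMod 2)[X]) = X + C 1 by simp,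
    natDegree_X_add_C, mul_one]

theorem shift_shift (p : (ZMod 2)[X]) : shift (shift p) = p := by
  have two : (2 : (ZMod 2)[X]) = 0 := CharTwo.two_eq_zero
  rw [shift_apply, shift_apply, comp_assoc, show (X + 1 : (ZMod 2)[X]).comp (X + 1) = X by
    rw [add_comp, X_comp, one_comp]; linear_combination two, comp_X]

theorem shift_mul (p q : (ZMod 2)[X]) : shift (p * q) = shift p * shift q := mul_comp _ _ _

theorem shift_mem_degreeLT {p : (ZMod 2)[X]} {n : ℕ} (hp : p ∈ degreeLT (ZMod 2) n) :
    shift p ∈ degreeLT (ZMod 2) n := by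
  by_cases h0 : p = 0
  · rw [h0, map_zero]; exact Submodule.zero_mem _
  rw [mem_degreeLT] at hp ⊢
  refine degree_le_natDegree.trans_lt ?_
  rwa [natDegree_shift, ← degree_eq_natDegree h0]

/-- Conjugating by the shift turns multiplication by `X + 1` into multiplication by `X`, and `D + 1`
satisfies `(D + 1)⁴ = D + 1` in characteristic two. -/
theorem Decomposes.of_shift {f : (ZMod 2)[X]} (hf : Decomposes (shift f)) : Decomposes f := by
  have two : (2 : (ZMod 2)[X]) = 0 := CharTwo.two_eq_zero
  obtain ⟨N, D, hND⟩ := hf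
  rw [natDegree_shift] at hND
  refine ⟨shift ∘ₗ N ∘ₗ shift, shift ∘ₗ D ∘ₗ shift + LinearMap.id, fun p hp => ?_⟩
  obtain ⟨e1, e2, ⟨q, e3⟩, e4, e5⟩ := hND _ (shift_mem_degreeLT hp)
  simp only [LinearMap.add_apply, LinearMap.comp_apply, LinearMap.id_apply, map_add, shift_shift]
  refine ⟨shift_mem_degreeLT e1, Submodule.add_mem _ (shift_mem_degreeLT e2) hp,
    ⟨shift q, ?_⟩, ?_, ?_⟩
  · have := congrArg shift e3
    rw [map_sub, shift_mul, shift_mul, shift_shift, shift_shift, map_add, shift_apply X,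
      X_comp] at this
    linear_combination this - p * two
  · rw [e4, map_zero]
  · rw [e5]
    linear_combination (shift (D (D (D (shift p)))) * 2 + shift (D (D (shift p))) * 3 +
      shift (D (shift p)) * 2) * two

/-! ### Every monic polynomial decomposes -/

/-- Two monic polynomials of degree `n + 1` with the same second coefficient differ by a polynomial
of degree less than `n`. -/
theorem sub_mem_degreeLT_of_nextCoeff_eq {f g : (ZMod 2)[X]} {n : ℕ} (hf : f.Monic)
    (hg : g.Monic) (hfn : f.natDegree = n + 1) (hgn : g.natDegree = n + 1)
    (h : f.nextCoeff = g.nextCoeff) : f - g ∈ degreeLT (ZMod 2) n := by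
  rw [mem_degreeLT, degree_lt_iff_coeff_zero]
  rw [nextCoeff_of_natDegree_pos (by omega), nextCoeff_of_natDegree_pos (by omega), hfn, hgn] at h
  intro m hm
  rw [coeff_sub, sub_eq_zero]
  rcases hm.eq_or_lt with rfl | hm
  · exact h
  rcases (Nat.succ_le_of_lt hm).eq_or_lt with hm | hm
  · rw [Nat.succ_eq_add_one] at hm
    have e1 := hf.coeff_natDegree
    have e2 := hg.coeff_natDegree
    rw [hfn, hm] at e1
    rw [hgn, hm] at e2
    rw [e1, e2]
  · rw [coeff_eq_zero_of_natDegree_lt (by omega), coeff_eq_zero_of_natDegree_lt (by omega)]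

/-- The second coefficient decides whether `f` has the form `X * g - r` with `deg r < deg g`. -/
theorem CubeRootDecomposes.decomposes_of_nextCoeff_eq {f g : (ZMod 2)[X]}
    (hdec : CubeRootDecomposes g) (hg : g.Monic) (hf : f.Monic)
    (hn : f.natDegree = g.natDegree + 1) (h : f.nextCoeff = g.nextCoeff) : Decomposes f := by
  have := sub_mem_degreeLT_of_nextCoeff_eq hf (monic_X.mul hg) hn
    (natDegree_X_mul hg.ne_zero) (by
      rw [h, monic_X.nextCoeff_mul hg, ← zero_add g.nextCoeff]
      simpa using nextCoeff_X_add_C (0 : ZMod 2))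
  simpa using hdec.decomposes hg (Submodule.neg_mem _ this)

theorem monic_X_sq_add_X_add_one : (X ^ 2 + X + 1 : (ZMod 2)[X]).Monic := by monicity!

theorem natDegree_X_sq_add_X_add_one : (X ^ 2 + X + 1 : (ZMod 2)[X]).natDegree = 2 := by
  compute_degree!

theorem monic_X_cube_sub_one : (X ^ 3 - 1 : (ZMod 2)[X]).Monic := by monicity!

theorem natDegree_X_cube_sub_one : (X ^ 3 - 1 : (ZMod 2)[X]).natDegree = 3 := by
  compute_degree!

theorem nextCoeff_X_sq_add_X_add_one : (X ^ 2 + X + 1 : (ZMod 2)[X]).nextCoeff = 1 := by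
  rw [nextCoeff_of_natDegree_pos (by rw [natDegree_X_sq_add_X_add_one]; norm_num),
    natDegree_X_sq_add_X_add_one]
  simp [coeff_X, coeff_one]

theorem nextCoeff_X_cube_sub_one : (X ^ 3 - 1 : (ZMod 2)[X]).nextCoeff = 0 := by
  rw [nextCoeff_of_natDegree_pos (by rw [natDegree_X_cube_sub_one]; norm_num),
    natDegree_X_cube_sub_one]
  simp [coeff_X_pow, coeff_one]

theorem CubeRootDecomposes.mul_pow {g : (ZMod 2)[X]} (hdec : CubeRootDecomposes g)
    (hg : g.Monic) (q : ℕ) : CubeRootDecomposes (g * (X ^ 2 + X + 1) ^ q) := by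
  induction q with
  | zero => simpa using hdec
  | succ q ih =>
    rw [pow_succ, ← mul_assoc]
    exact ih.mul (hg.mul (monic_X_sq_add_X_add_one.pow q)) monic_X_sq_add_X_add_one
      ⟨X - 1, by ring⟩ natDegree_X_sq_add_X_add_one.ge

theorem cubeRootDecomposes_X_add_one : CubeRootDecomposes (X + 1) :=
  cubeRootDecomposes_of_dvd (by monicity!) ⟨X ^ 2 + X + 1, by
    have two : (2 : (ZMod 2)[X]) = 0 := CharTwo.two_eq_zero
    linear_combination -(X ^ 2 + X + 1) * two⟩

theorem zmod_two_eq_or (a b : ZMod 2) : a = b ∨ a = b + 1 := by revert a b; decide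

/-- If the second coefficient of `f` is not that of `X * W ^ q`, where `W = X ^ 2 + X + 1`, then it
is that of `(X + 1) * W ^ q`, which the shift sends to `X * W ^ q`. -/
theorem decomposes_of_odd {f : (ZMod 2)[X]} (hf : f.Monic) {q : ℕ}
    (hn : f.natDegree = 2 * q + 1) : Decomposes f := by
  have hW := monic_X_sq_add_X_add_one.pow q
  have hWd : ((X ^ 2 + X + 1 : (ZMod 2)[X]) ^ q).natDegree = 2 * q := by
    rw [monic_X_sq_add_X_add_one.natDegree_pow, natDegree_X_sq_add_X_add_one, mul_comm]
  have hdec : CubeRootDecomposes ((X ^ 2 + X + 1) ^ q) := by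
    simpa using (cubeRootDecomposes_of_dvd monic_one (one_dvd _)).mul_pow monic_one q
  rcases zmod_two_eq_or f.nextCoeff ((X ^ 2 + X + 1) ^ q : (ZMod 2)[X]).nextCoeff with h | h
  · exact hdec.decomposes_of_nextCoeff_eq hW hf (by rw [hn, hWd]) h
  have hX : (X + 1 : (ZMod 2)[X]).Monic := by monicity!
  have hX1 : (X + 1 : (ZMod 2)[X]).natDegree = 1 := by compute_degree!
  have hr := sub_mem_degreeLT_of_nextCoeff_eq hf (hX.mul hW) hn
    (by rw [hX.natDegree_mul hW, hWd, hX1, add_comm])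
    (by rw [h, hX.nextCoeff_mul hW, show (X + 1 : (ZMod 2)[X]) = X + C 1 by simp,
          nextCoeff_X_add_C, add_comm])
  have := hdec.decomposes hW
    (by rw [hWd]; exact Submodule.neg_mem _ (shift_mem_degreeLT hr))
  refine Decomposes.of_shift ?_
  convert this using 1
  have two : (2 : (ZMod 2)[X]) = 0 := CharTwo.two_eq_zero
  rw [map_sub, shift_mul, shift_apply (X + 1), shift_apply (_ ^ q), pow_comp]
  simp only [add_comp, X_comp, pow_comp, one_comp]
  rw [show ((X + 1) ^ 2 + (X + 1) + 1 : (ZMod 2)[X]) = X ^ 2 + X + 1 by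
    linear_combination (X + 1) * two]
  linear_combination (X ^ 2 + X + 1) ^ q * two

theorem eq_sum_coeff {f : (ZMod 2)[X]} (hf : f.Monic) {n : ℕ} (hn : f.natDegree = n) :
    f = ∑ i ∈ Finset.range n, C (f.coeff i) * X ^ i + X ^ n := by
  have := f.as_sum_range_C_mul_X_pow
  rw [Finset.sum_range_succ, hf.coeff_natDegree, hn, map_one, one_mul] at this
  exact this

theorem decomposes_of_natDegree_two {f : (ZMod 2)[X]} (hf : f.Monic) (hn : f.natDegree = 2)
    (hc : f.coeff 1 = 0) : Decomposes f := by
  have two : (2 : (ZMod 2)[X]) = 0 := CharTwo.two_eq_zero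
  have e := eq_sum_coeff hf hn
  simp only [Finset.sum_range_succ, Finset.sum_range_zero, hc] at e
  rcases zmod_two_eq_or (f.coeff 0) 0 with h | h
  · have : f = X ^ 2 := by rw [e, h]; simp
    rw [this]; exact decomposes_X_sq
  · refine Decomposes.of_shift ?_
    have : shift f = X ^ 2 := by
      rw [e, h, shift_apply]
      simp
      linear_combination (X + 1) * two
    rw [this]; exact decomposes_X_sq

theorem decomposes_of_natDegree_four {f : (ZMod 2)[X]} (hf : f.Monic) (hn : f.natDegree = 4)
    (hc : f.coeff 3 = 1) : Decomposes f := by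
  have two : (2 : (ZMod 2)[X]) = 0 := CharTwo.two_eq_zero
  have e := eq_sum_coeff hf hn
  simp only [Finset.sum_range_succ, Finset.sum_range_zero, hc] at e
  rcases zmod_two_eq_or (f.coeff 2) 0 with h | h
  · refine Decomposes.of_shift ?_
    have : shift f = X ^ 4 + X ^ 3 + X ^ 2 + C (f.coeff 1 + 1) * X +
        C (f.coeff 1 + f.coeff 0) := by
      conv_lhs => rw [e, h, shift_apply]
      simp
      linear_combination (2 * X ^ 3 + 4 * X ^ 2 + 3 * X + 1) * two
    rw [this]; exact decomposes_quartic _ _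
  · have : f = X ^ 4 + X ^ 3 + X ^ 2 + C (f.coeff 1) * X + C (f.coeff 0) := by
      conv_lhs => rw [e, h]
      simp
      ring
    rw [this]; exact decomposes_quartic _ _

theorem decomposes_of_natDegree_six {f : (ZMod 2)[X]} (hf : f.Monic) (hn : f.natDegree = 6)
    (hc : f.coeff 5 = 0) : Decomposes f := by
  have two : (2 : (ZMod 2)[X]) = 0 := CharTwo.two_eq_zero
  have e := eq_sum_coeff hf hn
  simp only [Finset.sum_range_succ, Finset.sum_range_zero, hc] at e
  rcases zmod_two_eq_or (f.coeff 4) 0 with h | h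
  · refine Decomposes.of_shift ?_
    have : shift f = (X ^ 3 + X ^ 2 + X) ^ 2 + C (f.coeff 2) * X ^ 2 +
        C (f.coeff 3) * (X ^ 3 + X ^ 2 + X) + C (f.coeff 1) * X +
        C (1 + f.coeff 3 + f.coeff 2 + f.coeff 1 + f.coeff 0) := by
      conv_lhs => rw [e, h, shift_apply]
      simp
      linear_combination (2 * X ^ 5 + 6 * X ^ 4 + 9 * X ^ 3 + 7 * X ^ 2 + 3 * X +
        C (f.coeff 3) * (X ^ 2 + X) + C (f.coeff 2) * X) * two
    rw [this]; exact decomposes_sextic _ _ _ _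
  · have : f = (X ^ 3 + X ^ 2 + X) ^ 2 + C (1 + f.coeff 2 + f.coeff 3) * X ^ 2 +
        C (f.coeff 3) * (X ^ 3 + X ^ 2 + X) + C (f.coeff 1 + f.coeff 3) * X +
        C (f.coeff 0) := by
      conv_lhs => rw [e, h]
      simp
      linear_combination -(X ^ 5 + X ^ 4 + X ^ 3 + X ^ 2 + C (f.coeff 3) * (X ^ 2 + X)) * two
    rw [this]; exact decomposes_sextic _ _ _ _

theorem decomposes_of_even {f : (ZMod 2)[X]} (hf : f.Monic) {m : ℕ}
    (hn : f.natDegree = 2 * (m + 1)) : Decomposes f := by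
  have hX : (X + 1 : (ZMod 2)[X]).Monic := by monicity!
  have hX1 : (X + 1 : (ZMod 2)[X]).natDegree = 1 := by compute_degree!
  have hXc : (X + 1 : (ZMod 2)[X]).nextCoeff = 1 := by
    rw [show (X + 1 : (ZMod 2)[X]) = X + C 1 by simp, nextCoeff_X_add_C]
  have hW := fun q => monic_X_sq_add_X_add_one.pow q
  have hWd : ∀ q, ((X ^ 2 + X + 1 : (ZMod 2)[X]) ^ q).natDegree = 2 * q := fun q => by
    rw [monic_X_sq_add_X_add_one.natDegree_pow, natDegree_X_sq_add_X_add_one, mul_comm]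
  have hWc : ∀ q : ℕ, ((X ^ 2 + X + 1 : (ZMod 2)[X]) ^ q).nextCoeff = (q : ZMod 2) := fun q => by
    rw [monic_X_sq_add_X_add_one.nextCoeff_pow, nextCoeff_X_sq_add_X_add_one, nsmul_one]
  rcases zmod_two_eq_or f.nextCoeff (m + 1) with h | h
  · refine (cubeRootDecomposes_X_add_one.mul_pow hX m).decomposes_of_nextCoeff_eq
      (hX.mul (hW m)) hf ?_ ?_
    · rw [hX.natDegree_mul (hW m), hX1, hWd, hn]; ring
    · rw [h, hX.nextCoeff_mul (hW m), hXc, hWc, add_comm]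
  -- The other second coefficient needs two factors `X ^ 3 - 1`, hence degree at least eight.
  have hcoeff := nextCoeff_of_natDegree_pos (p := f) (by omega)
  rw [h, hn] at hcoeff
  match m, hn, h, hcoeff with
  | 0, hn, _, hcoeff => exact decomposes_of_natDegree_two hf hn (hcoeff.symm.trans (by decide))
  | 1, hn, _, hcoeff => exact decomposes_of_natDegree_four hf hn (hcoeff.symm.trans (by decide))
  | 2, hn, _, hcoeff => exact decomposes_of_natDegree_six hf hn (hcoeff.symm.trans (by decide))
  | k + 3, hn, h, _ =>
    have hU := monic_X_cube_sub_one
    have hUd := natDegree_X_cube_sub_one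
    have hUc := nextCoeff_X_cube_sub_one
    have hdec := ((cubeRootDecomposes_X_add_one.mul hX hU dvd_rfl (by omega)).mul
      (hX.mul hU) hU dvd_rfl (by omega)).mul_pow ((hX.mul hU).mul hU) k
    refine hdec.decomposes_of_nextCoeff_eq (((hX.mul hU).mul hU).mul (hW k)) hf ?_ ?_
    · rw [((hX.mul hU).mul hU).natDegree_mul (hW k), (hX.mul hU).natDegree_mul hU,
        hX.natDegree_mul hU, hX1, hUd, hWd, hn]
      ring
    · rw [h, ((hX.mul hU).mul hU).nextCoeff_mul (hW k), (hX.mul hU).nextCoeff_mul hU,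
        hX.nextCoeff_mul hU, hXc, hUc, hWc]
      push_cast
      generalize (k : ZMod 2) = x
      revert x
      decide

theorem decomposes_of_monic {f : (ZMod 2)[X]} (hf : f.Monic) : Decomposes f := by
  obtain ⟨k, hk | hk⟩ := Nat.even_or_odd' f.natDegree
  · cases k with
    | zero =>
      refine ⟨0, 0, fun p _ => ⟨Submodule.zero_mem _, Submodule.zero_mem _, ?_, rfl, rfl⟩⟩
      rw [hf.natDegree_eq_zero.1 hk]
      exact one_dvd _
    | succ m => exact decomposes_of_even hf hk
  · exact decomposes_of_odd hf hk

/-! ### From polynomials to matrices -/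

/-- The action of `X` on the `𝔽₂[X]`-module `M` is the sum of an `𝔽₂`-linear map `N` with
`N² = 0` and an `𝔽₂`-linear map `D` with `D⁴ = D`. -/
def XActionDecomposes (M : Type*) [AddCommGroup M] [Module (ZMod 2) M] [Module (ZMod 2)[X] M] :
    Prop :=
  ∃ N D : M →ₗ[ZMod 2] M, ∀ m, N (N m) = 0 ∧ D (D (D (D m))) = D m ∧
    (X : (ZMod 2)[X]) • m = N m + D m

theorem XActionDecomposes.of_equiv {M M' : Type*} [AddCommGroup M] [Module (ZMod 2) M]
    [Module (ZMod 2)[X] M] [IsScalarTower (ZMod 2) (ZMod 2)[X] M]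
    [AddCommGroup M'] [Module (ZMod 2) M'] [Module (ZMod 2)[X] M']
    [IsScalarTower (ZMod 2) (ZMod 2)[X] M'] (e : M ≃ₗ[(ZMod 2)[X]] M')
    (h : XActionDecomposes M') : XActionDecomposes M := by
  obtain ⟨N, D, h⟩ := h
  set e' := e.restrictScalars (ZMod 2) with he
  refine ⟨e'.symm.toLinearMap ∘ₗ N ∘ₗ e'.toLinearMap, e'.symm.toLinearMap ∘ₗ D ∘ₗ e'.toLinearMap,
    fun m => ?_⟩
  obtain ⟨h1, h2, h3⟩ := h (e' m)
  simp only [LinearMap.comp_apply, LinearEquiv.coe_coe, LinearEquiv.apply_symm_apply, h1, h2,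
    map_zero, true_and]
  rw [← map_add, ← h3, LinearEquiv.eq_symm_apply]
  exact map_smul e X m

theorem XActionDecomposes.directSum {ι : Type*} (M : ι → Type*) [∀ i, AddCommGroup (M i)]
    [∀ i, Module (ZMod 2) (M i)] [∀ i, Module (ZMod 2)[X] (M i)]
    (h : ∀ i, XActionDecomposes (M i)) : XActionDecomposes (DirectSum ι M) := by
  choose N D h using h
  refine ⟨DirectSum.lmap N, DirectSum.lmap D, fun m => ⟨?_, ?_, ?_⟩⟩ <;>
    refine DFinsupp.ext fun i => ?_
  · exact (h i (m i)).1
  · exact (h i (m i)).2.1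
  · exact (h i (m i)).2.2

theorem Decomposes.xActionDecomposes {f : (ZMod 2)[X]} (hf : f.Monic) (h : Decomposes f) :
    XActionDecomposes ((ZMod 2)[X] ⧸ Submodule.span (ZMod 2)[X] {f}) := by
  obtain ⟨N, D, h⟩ := h
  set I := Submodule.span (ZMod 2)[X] {f} with hI
  obtain ⟨π, hπ⟩ : ∃ π : (ZMod 2)[X] →ₗ[ZMod 2] (ZMod 2)[X] ⧸ I, ∀ p, π p = I.mkQ p :=
    ⟨I.mkQ.restrictScalars (ZMod 2), fun _ => rfl⟩
  obtain ⟨ρ, hρ⟩ : ∃ ρ : ((ZMod 2)[X] ⧸ I) →ₗ[ZMod 2] (ZMod 2)[X], ∀ p, ρ (I.mkQ p) = p %ₘ f :=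
    ⟨AdjoinRoot.modByMonicHom hf, AdjoinRoot.modByMonicHom_mk hf⟩
  have hρπ : ∀ p ∈ degreeLT (ZMod 2) f.natDegree, ρ (π p) = p := fun p hp => by
    rw [hπ, hρ, modByMonic_eq_self_of_mem hf hp]
  have hπ_eq : ∀ p q, f ∣ p - q → π p = π q := fun p q hpq => by
    rw [hπ, hπ, Submodule.mkQ_apply, Submodule.mkQ_apply, Submodule.Quotient.eq]
    exact Ideal.mem_span_singleton.2 hpq
  have hD : ∀ q ∈ degreeLT (ZMod 2) f.natDegree, D q ∈ degreeLT (ZMod 2) f.natDegree :=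
    fun q hq => (h q hq).2.1
  refine ⟨π ∘ₗ N ∘ₗ ρ, π ∘ₗ D ∘ₗ ρ, fun m => ?_⟩
  obtain ⟨p, rfl⟩ := I.mkQ_surjective m
  obtain ⟨h1, h2, h3, h4, h5⟩ := h _ (modByMonic_mem_degreeLT hf p)
  simp only [LinearMap.comp_apply, hρ]
  refine ⟨?_, ?_, ?_⟩
  · rw [hρπ _ h1, h4, map_zero]
  · rw [hρπ _ h2, hρπ _ (hD _ h2), hρπ _ (hD _ (hD _ h2)), h5]
  · rw [← map_add, ← hπ_eq _ _ h3, ← map_smul, ← hπ, smul_eq_mul]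
    refine hπ_eq _ _ ⟨X * (p /ₘ f), ?_⟩
    linear_combination -X * modByMonic_add_div p f

theorem xActionDecomposes_of_finite (M : Type) [AddCommGroup M] [Module (ZMod 2) M]
    [Module (ZMod 2)[X] M] [IsScalarTower (ZMod 2) (ZMod 2)[X] M] [Module.Finite (ZMod 2)[X] M]
    (hM : Module.IsTorsion (ZMod 2)[X] M) : XActionDecomposes M := by
  obtain ⟨ι, _, p, hp, e, ⟨l⟩⟩ := Module.equiv_directSum_of_isTorsion hM
  refine XActionDecomposes.of_equiv l (XActionDecomposes.directSum _ fun i => ?_)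
  -- Over the field with two elements every nonzero polynomial is monic.
  have hmonic : (p i ^ e i).Monic :=
    (by decide : ∀ a : ZMod 2, a ≠ 0 → a = 1) _
      (leadingCoeff_ne_zero.2 (pow_ne_zero _ (hp i).ne_zero))
  exact (decomposes_of_monic hmonic).xActionDecomposes hmonic

theorem corollary3p3 (n : ℕ) (A : Matrix (Fin n) (Fin n) (ZMod 2)) :
    ∃ N D : Matrix (Fin n) (Fin n) (ZMod 2), N ^ 2 = 0 ∧ D ^ 4 = D ∧ A = N + D := by
  set φ := Matrix.toLin' A with hφ
  obtain ⟨N, D, h⟩ := xActionDecomposes_of_finite (Module.AEval' φ)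
    (Module.AEval.isTorsion_of_finiteDimensional (ZMod 2) _ φ)
  let e := Module.AEval'.of φ
  let conj : (Module.AEval' φ →ₗ[ZMod 2] Module.AEval' φ) →
      ((Fin n → ZMod 2) →ₗ[ZMod 2] (Fin n → ZMod 2)) :=
    fun T => e.symm.toLinearMap ∘ₗ T ∘ₗ e.toLinearMap
  have hc : ∀ T v, conj T v = e.symm (T (e v)) := fun _ _ => rfl
  refine ⟨LinearMap.toMatrix' (conj N), LinearMap.toMatrix' (conj D), ?_, ?_, ?_⟩
  · rw [pow_two, ← LinearMap.toMatrix'_mul, ← map_zero LinearMap.toMatrix']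
    congr 1
    refine LinearMap.ext fun v => ?_
    rw [Module.End.mul_apply, hc, hc, e.apply_symm_apply, (h _).1, map_zero,
      LinearMap.zero_apply]
  · rw [show ∀ B : Matrix (Fin n) (Fin n) (ZMod 2), B ^ 4 = B * (B * (B * B)) from
        fun B => by noncomm_ring,
      ← LinearMap.toMatrix'_mul, ← LinearMap.toMatrix'_mul, ← LinearMap.toMatrix'_mul]
    congr 1
    refine LinearMap.ext fun v => ?_
    simp only [Module.End.mul_apply, hc, e.apply_symm_apply, (h _).2.1]
  · rw [← map_add, ← LinearMap.toMatrix'_toLin' A]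
    congr 1
    refine LinearMap.ext fun v => ?_
    rw [LinearMap.add_apply, hc, hc, ← map_add, ← (h _).2.2, LinearEquiv.eq_symm_apply]
    exact (Module.AEval'.X_smul_of φ v).symm
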